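/- Let $d\ge 1$, $0<s<1$, and let $\Omega\subset\mathbb R^d$ be a bounded open set with Lipschitz boundary. Put $\Omega_c=\mathbb R^d\setminus\overline\Omega$ and, for $\delta>0$, $\Omega_{I_\delta}=\{y\in\Omega_c:\operatorname{dist}(y,\Omega)<\delta\}$, $\widehat\Omega_\delta=\Omega\cup\Omega_{I_\delta}$ and $\widetilde\Omega_\delta=\widehat\Omega_\delta^2\setminus\Omega_{I_\delta}^2$. Let $$\gamma_s(x,y)=\frac{C_{d,s}}{|y-x|^{d+2s}},\qquad C_{d,s}=\frac{2^{2s}\,s\,\Gamma(s+d/2)}{\pi^{d/2}\,\Gamma(1-s)},\qquad \gamma_\delta(x,y)=\gamma_s(x,y)\ \text{if } |y-x|<\delta,\quad \gamma_\delta(x,y)=0\ \text{otherwise.}$$ For measurable $U\subset\mathbb R^d$ let $\|u\|_{H^s(U)}^2=\int_U|u|^2\,dx+\iint_{U\times U}\frac{|u(y)-u(x)|^2}{|y-x|^{d+2s}}\,dy\,dx$, and let $H^s_c(\mathbb R^d)$ be the space of all $v\in H^s(\mathbb R^d)$ with $v=0$ a.e. on $\Omega_c$. Let $V_\delta$ be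 the space of all $v\in L^2(\widehat\Omega_\delta)$ for which $$\|v\|_{V_\delta}^2=\tfrac12\iint_{\widetilde\Omega_\delta}(v(y)-v(x))^2\gamma_\delta(x,y)\,dy\,dx+\int_{\widehat\Omega_\delta}|v|^2\,dx$$ is finite, and let $V_{c,\delta}$ be the subspace of those $v\in V_\delta$ with $v=0$ a.e. on $\Omega_{I_\delta}$, with the same norm and with dual $V_\delta^*$. Put $$A_\delta(u,v)=\tfrac12\iint_{\widetilde\Omega_\delta}(v(y)-v(x))(u(y)-u(x))\gamma_\delta(x,y)\,dy\,dx,$$ $$A_s(u,v)=\tfrac12\iint_{(\mathbb R^d\times\mathbb R^d)\setminus(\Omega_c\times\Omega_c)}(v(y)-v(x))(u(y)-u(x))\gamma_s(x,y)\,dy\,dx.$$ Let $w\in H^s(\mathbb R^d)$. Let $f$ be a source term on $\Omega$, independent of $\delta$, that is, a linear functional $v\mapsto (f,v)$ depending only on $v|_\Omega$ (for instance $(f,v)=\int_\Omega fv\,dx$ with a function $f$). Its extension $\widehat f$ by zero to $\Omega_{I_\delta}$ acts on $V_{c,\delta}$ by $v\mapsto(f,v|_\Omega)$. For large $\delta$,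 let $u_\delta$ be the weak solution of the nonlocal Dirichlet problem with data $w$, that is, $u_\delta\in V_\delta$, $u_\delta=w$ a.e. on $\Omega_{I_\delta}$, and $A_\delta(u_\delta,v)=(f,v|_\Omega)$ for all $v\in V_{c,\delta}$. Let $u_\infty$ be the weak solution of the fractional Dirichlet problem with data $w$, that is, $u_\infty\in H^s(\mathbb R^d)$, $u_\infty=w$ a.e. on $\Omega_c$, and $A_s(u_\infty,v)=(f,v|_\Omega)$ for all $v\in H^s_c(\mathbb R^d)$. If $\|\widehat f\|_{V_\delta^*}$ is bounded uniformly in all large $\delta$, then $$\|u_\delta-u_\infty\|_{H^s(\Omega)}\to0\qquad\text{as }\delta\to\infty .$$ -/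

import Mathlib

open MeasureTheory Filter Topology
open scoped ENNReal NNReal

noncomputable section

namespace NonlocalDiffusion

/-- `Ω ⊆ ℝ^d` has a Lipschitz boundary: near every boundary point, `Ω` is, in suitable orthonormal
coordinates with vertical direction `ν`, the set of points strictly below the graph of a Lipschitz
function on the hyperplane orthogonal to `ν`. -/
def HasLipschitzBoundary {d : ℕ} (Ω : Set (EuclideanSpace ℝ (Fin d))) : Prop :=
  ∀ x ∈ frontier Ω, ∃ ν : EuclideanSpace ℝ (Fin d), ‖ν‖ = 1 ∧
    ∃ (K : ℝ≥0) (φ : ↥((Submodule.span ℝ {ν})ᗮ) → ℝ), LipschitzWith K φ ∧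
      ∃ r > 0, ∀ y ∈ Metric.ball x r,
        (y ∈ Ω ↔ inner ℝ ν y < φ ((Submodule.span ℝ {ν})ᗮ.orthogonalProjectionOnto y))

/-- The exterior domain `Ω_c = ℝ^d \ closure Ω`. -/
def exterior {d : ℕ} (Ω : Set (EuclideanSpace ℝ (Fin d))) : Set (EuclideanSpace ℝ (Fin d)) :=
  (closure Ω)ᶜ

/-- The interaction layer `{y ∈ Ω_c | dist(y, Ω) < δ}`. -/
def layer {d : ℕ} (Ω : Set (EuclideanSpace ℝ (Fin d))) (δ : ℝ) :
    Set (EuclideanSpace ℝ (Fin d)) :=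
  {y | y ∈ exterior Ω ∧ Metric.infDist y Ω < δ}

/-- The extended domain: the union of `Ω` and its interaction layer. -/
def extDomain {d : ℕ} (Ω : Set (EuclideanSpace ℝ (Fin d))) (δ : ℝ) :
    Set (EuclideanSpace ℝ (Fin d)) :=
  Ω ∪ layer Ω δ

/-- The set of interacting pairs: all pairs of points of the extended domain,
except those with both points in the interaction layer. -/
def pairDomain {d : ℕ} (Ω : Set (EuclideanSpace ℝ (Fin d))) (δ : ℝ) :
    Set (EuclideanSpace ℝ (Fin d) × EuclideanSpace ℝ (Fin d)) :=
  (extDomain Ω δ ×ˢ extDomain Ω δ) \ (layer Ω δ ×ˢ layer Ω δ)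

/-- The constant `C_{d,s} = 2^{2s} s Γ(s + d/2) / (π^{d/2} Γ(1 - s))`. -/
def fracConst (d : ℕ) (s : ℝ) : ℝ :=
  2 ^ (2 * s) * s * Real.Gamma (s + (d : ℝ) / 2) /
    (Real.pi ^ ((d : ℝ) / 2) * Real.Gamma (1 - s))

/-- The fractional kernel `γ_s(x, y) = C_{d,s} / |y - x|^{d+2s}`. -/
def fracKernel {d : ℕ} (s : ℝ) (x y : EuclideanSpace ℝ (Fin d)) : ℝ :=
  fracConst d s / ‖y - x‖ ^ ((d : ℝ) + 2 * s)

open Classical in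
/-- The truncated kernel `γ_δ`: equal to `γ_s(x, y)` if `y - x ∈ B_δ(0)`, and `0` otherwise. -/
def truncKernel {d : ℕ} (s δ : ℝ) (x y : EuclideanSpace ℝ (Fin d)) : ℝ :=
  if y - x ∈ Metric.ball (0 : EuclideanSpace ℝ (Fin d)) δ then fracKernel s x y else 0

/-! ### Fractional Sobolev spaces -/

/-- The (extended) norm of `H^s(U)`,
`(∫_U |u|² + ∫_U ∫_U |u(y) - u(x)|² / |y - x|^{d+2s} dy dx)^{1/2}`. -/
def HsNorm {d : ℕ} (s : ℝ) (U : Set (EuclideanSpace ℝ (Fin d)))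
    (u : EuclideanSpace ℝ (Fin d) → ℝ) : ℝ≥0∞ :=
  ((∫⁻ x in U, ENNReal.ofReal (u x ^ 2)) +
    ∫⁻ p in U ×ˢ U,
      ENNReal.ofReal ((u p.2 - u p.1) ^ 2 / ‖p.2 - p.1‖ ^ ((d : ℝ) + 2 * s))) ^ (1 / 2 : ℝ)

/-- `u ∈ H^s(U)`. -/
def MemHs {d : ℕ} (s : ℝ) (U : Set (EuclideanSpace ℝ (Fin d)))
    (u : EuclideanSpace ℝ (Fin d) → ℝ) : Prop :=
  AEStronglyMeasurable u (volume.restrict U) ∧ HsNorm s U u < ∞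

/-- `u ∈ H^s_c(ℝ^d)`: `u ∈ H^s(ℝ^d)` and `u = 0` a.e. on `Ω_c`. -/
def MemHsc {d : ℕ} (s : ℝ) (Ω : Set (EuclideanSpace ℝ (Fin d)))
    (u : EuclideanSpace ℝ (Fin d) → ℝ) : Prop :=
  MemHs s Set.univ u ∧ ∀ᵐ x ∂volume.restrict (exterior Ω), u x = 0

/-! ### The nonlocal energy spaces

A function on the extended domain is represented by a function on `ℝ^d` whose values outside the
extended domain play no role. -/

/-- The (extended) norm of the energy space `V_δ`,
`(½ ∬ (v(y) - v(x))² γ_δ(x, y) dy dx + ∫ |v|²)^{1/2}`, the double integral being over the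
interacting pairs and the single one over the extended domain. -/
def energyNorm {d : ℕ} (s : ℝ) (Ω : Set (EuclideanSpace ℝ (Fin d))) (δ : ℝ)
    (v : EuclideanSpace ℝ (Fin d) → ℝ) : ℝ≥0∞ :=
  (2⁻¹ * (∫⁻ p in pairDomain Ω δ,
      ENNReal.ofReal ((v p.2 - v p.1) ^ 2 * truncKernel s δ p.1 p.2)) +
    ∫⁻ x in extDomain Ω δ, ENNReal.ofReal (v x ^ 2)) ^ (1 / 2 : ℝ)

/-- `v` belongs to the energy space `V_δ`. -/
def MemV {d : ℕ} (s : ℝ) (Ω : Set (EuclideanSpace ℝ (Fin d))) (δ : ℝ)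
    (v : EuclideanSpace ℝ (Fin d) → ℝ) : Prop :=
  AEStronglyMeasurable v (volume.restrict (extDomain Ω δ)) ∧ energyNorm s Ω δ v < ∞

/-- `v` belongs to the constrained energy space `V_{c,δ}` of the pure Dirichlet problem:
`v ∈ V_δ` and `v = 0` a.e. on the interaction layer. -/
def MemVc {d : ℕ} (s : ℝ) (Ω : Set (EuclideanSpace ℝ (Fin d))) (δ : ℝ)
    (v : EuclideanSpace ℝ (Fin d) → ℝ) : Prop :=
  MemV s Ω δ v ∧ ∀ᵐ x ∂volume.restrict (layer Ω δ), v x = 0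

/-- The norm of the source term in the dual of `V_{c,δ}`. The source term is a linear
functional `f` of functions on `Ω` (its extension by zero to the interaction layer ignores the
values there); this norm is finite exactly if `f` is bounded on `V_{c,δ}`. Only the values of `f`
on `V_{c,δ}` matter. -/
def dualNorm {d : ℕ} (s : ℝ) (Ω : Set (EuclideanSpace ℝ (Fin d))) (δ : ℝ)
    (f : (Ω → ℝ) →ₗ[ℝ] ℝ) : ℝ≥0∞ :=
  ⨆ (v : EuclideanSpace ℝ (Fin d) → ℝ) (_ : MemVc s Ω δ v) (_ : energyNorm s Ω δ v ≤ 1),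
    ‖f (Ω.domRestrict v)‖ₑ

/-! ### Weak formulations -/

/-- The bilinear form `A_δ(u, v) = ½ ∬ (v(y) - v(x)) (u(y) - u(x)) γ_δ(x, y) dy dx`
over the interacting pairs. -/
def nonlocalForm {d : ℕ} (s : ℝ) (Ω : Set (EuclideanSpace ℝ (Fin d))) (δ : ℝ)
    (u v : EuclideanSpace ℝ (Fin d) → ℝ) : ℝ :=
  2⁻¹ * ∫ p in pairDomain Ω δ,
    (v p.2 - v p.1) * (u p.2 - u p.1) * truncKernel s δ p.1 p.2

/-- The bilinear form `A_s(u, v) = ½ ∬ (v(y) - v(x)) (u(y) - u(x)) γ_s(x, y) dy dx`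
over all pairs except those with both points in `Ω_c`. -/
def fractionalForm {d : ℕ} (s : ℝ) (Ω : Set (EuclideanSpace ℝ (Fin d)))
    (u v : EuclideanSpace ℝ (Fin d) → ℝ) : ℝ :=
  2⁻¹ * ∫ p in (exterior Ω ×ˢ exterior Ω)ᶜ,
    (v p.2 - v p.1) * (u p.2 - u p.1) * fracKernel s p.1 p.2

/-- `u` is a weak solution of the nonlocal Dirichlet problem: `-L_δ u = f` in `Ω`,
`u = g` on the interaction layer. -/
structure IsNonlocalSolution {d : ℕ} (s : ℝ) (Ω : Set (EuclideanSpace ℝ (Fin d))) (δ : ℝ)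
    (f : (Ω → ℝ) →ₗ[ℝ] ℝ) (g u : EuclideanSpace ℝ (Fin d) → ℝ) : Prop where
  mem : MemV s Ω δ u
  dirichlet : ∀ᵐ x ∂volume.restrict (layer Ω δ), u x = g x
  weak : ∀ v, MemVc s Ω δ v → nonlocalForm s Ω δ u v = f (Ω.domRestrict v)

/-- `u` is a weak solution of the fractional Dirichlet problem: `(-Δ)^s u = f` in `Ω`,
`u = g` on `Ω_c`. -/
structure IsFractionalSolution {d : ℕ} (s : ℝ) (Ω : Set (EuclideanSpace ℝ (Fin d)))
    (f : (Ω → ℝ) →ₗ[ℝ] ℝ) (g u : EuclideanSpace ℝ (Fin d) → ℝ) : Prop where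
  mem : MemHs s Set.univ u
  dirichlet : ∀ᵐ x ∂volume.restrict (exterior Ω), u x = g x
  weak : ∀ v, MemHsc s Ω v → fractionalForm s Ω u v = f (Ω.domRestrict v)

end NonlocalDiffusion

end

/-!
The forcing terms of the two problems coincide, so the weak formulations can be subtracted once a
common test function is available: the error `v = u_δ - u_∞` on `Ω`, extended by zero
(`memVc_and_memHsc_error`). Both solutions equal `w` on the interaction layer, hence on
interacting pairs the increments of `v` are those of `u_δ - u_∞`. The truncated form differs from
the fractional one only by the pairs at distance at least `δ` (up to a null set, since the
boundary of a Lipschitz domain is null: `volume_frontier_eq_zero`). Testing with `v` therefore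
gives (`setIntegral_energyDensity_error`)
`∬_{|y-x|<δ} (v(y) - v(x))² γ_s = ∬_{|y-x|≥δ} (v(y) - v(x)) (u_∞(y) - u_∞(x)) γ_s`.

By Young's inequality the right-hand side is at most `e` times the far energy of `v` plus
`(4e)⁻¹` times the far energy of `u_∞`. The far energy of `v` is bounded by its `L²` norm, as
`γ_s` is integrable at infinity (`setLIntegral_energyDensity_farPairs_le`), and the `L²` norm is
bounded by the near energy, since every point of the bounded set `Ω` interacts with an annulus
outside `Ω`, where `v = 0` (`poincareConst_mul_le`). For a small fixed `e` the first term is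
absorbed (`le_of_forall_young`), and the near energy of `v` is at most a constant independent of
`δ` times the far energy of `u_∞` (`setLIntegral_energyDensity_error_le`). The latter tends to zero by dominated
convergence, and the near energy of `v` controls the `H^s(Ω)` norm of the error
(`HsNorm_sub_le`).
-/

namespace NonlocalDiffusion

/-! ### The boundary of a Lipschitz domain is a null set -/

/-- The graph of a continuous function over a hyperplane is null, being disjoint from all its
translates in the vertical direction. -/
theorem volume_graph_eq_zero {d : ℕ} {ν : EuclideanSpace ℝ (Fin d)} (hν : ‖ν‖ = 1)
    {φ : ↥((Submodule.span ℝ {ν})ᗮ) → ℝ} (hφ : Continuous φ) :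
    volume {y : EuclideanSpace ℝ (Fin d) |
      inner ℝ ν y = φ ((Submodule.span ℝ {ν})ᗮ.orthogonalProjectionOnto y)} = 0 := by
  have hνP : (Submodule.span ℝ {ν})ᗮ.orthogonalProjectionOnto ν = 0 := by
    rw [Submodule.orthogonalProjectionOnto_eq_zero_iff]
    exact Submodule.le_orthogonal_orthogonal _ (Submodule.mem_span_singleton_self ν)
  refine Measure.addHaar_eq_zero_of_disjoint_translates (μ := volume)
    (fun n : ℕ => ((n : ℝ) + 1)⁻¹ • ν) ?_ ?_ ?_
  · refine (Metric.isBounded_closedBall (x := (0 : EuclideanSpace ℝ (Fin d))) (r := 1)).subset ?_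
    rintro _ ⟨n, rfl⟩
    rw [mem_closedBall_zero_iff, norm_smul, hν, mul_one, Real.norm_of_nonneg (by positivity)]
    exact inv_le_one_of_one_le₀ (by linarith [n.cast_nonneg (α := ℝ)])
  · intro m n hmn
    rw [Function.onFun, Set.disjoint_left]
    rintro y hm hn
    simp only [Set.singleton_add, Set.mem_image, Set.mem_ofPred_eq] at hm hn
    obtain ⟨a, ha, hay⟩ := hm
    obtain ⟨b, hb, hby⟩ := hn
    apply hmn
    have hP := congrArg (Submodule.span ℝ {ν})ᗮ.orthogonalProjectionOnto (hay.trans hby.symm)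
    have hI := congrArg (inner ℝ ν) (hay.trans hby.symm)
    simp only [map_add, map_smul, hνP, smul_zero, zero_add] at hP
    simp only [inner_add_right, inner_smul_right, real_inner_self_eq_norm_sq, hν, ha, hb, hP] at hI
    have h : ((m : ℝ) + 1)⁻¹ = ((n : ℝ) + 1)⁻¹ := by linarith
    exact_mod_cast add_right_cancel (inv_injective h)
  · refine (isClosed_eq ?_ ?_).measurableSet
    · fun_prop
    · exact hφ.comp (by fun_prop)

theorem volume_frontier_eq_zero {d : ℕ} {Ω : Set (EuclideanSpace ℝ (Fin d))} (hΩo : IsOpen Ω)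
    (hΩL : HasLipschitzBoundary Ω) : volume (frontier Ω) = 0 := by
  refine measure_null_of_locally_null _ fun x hx => ?_
  obtain ⟨ν, hν, K, φ, hφ, r, hr, h⟩ := hΩL x hx
  refine ⟨frontier Ω ∩ Metric.ball x r,
    inter_mem_nhdsWithin _ (Metric.ball_mem_nhds x hr), ?_⟩
  refine measure_mono_null ?_ (volume_graph_eq_zero hν hφ.continuous)
  rintro y ⟨hyf, hyb⟩
  rw [hΩo.frontier_eq] at hyf
  have hle := not_lt.1 (mt (h y hyb).2 hyf.2)
  refine le_antisymm (not_lt.1 fun hlt => ?_) hle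
  have hopen : IsOpen {z : EuclideanSpace ℝ (Fin d) |
      φ ((Submodule.span ℝ {ν})ᗮ.orthogonalProjectionOnto z) < inner ℝ ν z} :=
    isOpen_lt (hφ.continuous.comp (by fun_prop)) (by fun_prop)
  obtain ⟨z, ⟨hz1, hz2⟩, hz3⟩ := mem_closure_iff.1 hyf.1 _
    (hopen.inter Metric.isOpen_ball) ⟨hlt, hyb⟩
  exact lt_asymm hz1 ((h z hz2).1 hz3)

/-! ### The kernel -/

theorem fracConst_pos (d : ℕ) {s : ℝ} (hs0 : 0 < s) (hs1 : s < 1) : 0 < fracConst d s := by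
  have h1 : 0 < Real.Gamma (s + (d : ℝ) / 2) := Real.Gamma_pos_of_pos (by positivity)
  have h2 : 0 < Real.Gamma (1 - s) := Real.Gamma_pos_of_pos (by linarith)
  unfold fracConst
  positivity

theorem fracKernel_nonneg {d : ℕ} {s : ℝ} (hs0 : 0 < s) (hs1 : s < 1)
    (x y : EuclideanSpace ℝ (Fin d)) : 0 ≤ fracKernel s x y :=
  div_nonneg (fracConst_pos d hs0 hs1).le (by positivity)

theorem measurable_fracKernel {d : ℕ} (s : ℝ) :
    Measurable fun p : EuclideanSpace ℝ (Fin d) × EuclideanSpace ℝ (Fin d) =>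
      fracKernel s p.1 p.2 := by
  unfold fracKernel
  fun_prop

/-- The tail mass `∫_{‖z‖ ≥ 1} C_{d,s} / ‖z‖^{d+2s} dz` of the kernel. -/
noncomputable def tailMass (d : ℕ) (s : ℝ) : ℝ≥0∞ :=
  ∫⁻ z in {z : EuclideanSpace ℝ (Fin d) | 1 ≤ ‖z‖}, ENNReal.ofReal (fracKernel s 0 z)

theorem tailMass_lt_top (d : ℕ) {s : ℝ} (hs0 : 0 < s) (hs1 : s < 1) : tailMass d s < ∞ := by
  set r : ℝ := (d : ℝ) + 2 * s with hr
  have hint : Integrable fun z : EuclideanSpace ℝ (Fin d) =>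
      fracConst d s * 2 ^ r * (1 + ‖z‖) ^ (-r) :=
    (integrable_one_add_norm (by rw [finrank_euclideanSpace_fin]; linarith)).const_mul _
  refine lt_of_le_of_lt ?_ hint.lintegral_lt_top
  refine (setLIntegral_mono' (measurableSet_le measurable_const measurable_norm)
    fun z (hz : 1 ≤ ‖z‖) => ENNReal.ofReal_le_ofReal ?_).trans (setLIntegral_le_lintegral _ _)
  have hC := fracConst_pos d hs0 hs1
  have hr0 : 0 ≤ r := by positivity
  rw [fracKernel, sub_zero, Real.rpow_neg (by positivity), div_eq_mul_inv, mul_assoc]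
  refine mul_le_mul_of_nonneg_left ?_ hC.le
  rw [← div_eq_mul_inv, ← Real.div_rpow (by positivity) (by positivity),
    ← Real.inv_rpow (by positivity)]
  refine Real.rpow_le_rpow (by positivity) ?_ hr0
  rw [inv_eq_one_div, div_le_div_iff₀ (by positivity) (by positivity)]
  linarith

/-! ### Near and far pairs -/

/-- The pairs at distance less than `δ` that do not lie in `Ω_c × Ω_c`. -/
def nearPairs {d : ℕ} (Ω : Set (EuclideanSpace ℝ (Fin d))) (δ : ℝ) :
    Set (EuclideanSpace ℝ (Fin d) × EuclideanSpace ℝ (Fin d)) :=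
  (exterior Ω ×ˢ exterior Ω)ᶜ ∩ {p | ‖p.2 - p.1‖ < δ}

/-- The pairs at distance at least `δ` that do not lie in `Ω_c × Ω_c`. -/
def farPairs {d : ℕ} (Ω : Set (EuclideanSpace ℝ (Fin d))) (δ : ℝ) :
    Set (EuclideanSpace ℝ (Fin d) × EuclideanSpace ℝ (Fin d)) :=
  (exterior Ω ×ˢ exterior Ω)ᶜ ∩ {p | δ ≤ ‖p.2 - p.1‖}

theorem isOpen_exterior {d : ℕ} (Ω : Set (EuclideanSpace ℝ (Fin d))) : IsOpen (exterior Ω) :=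
  isClosed_closure.isOpen_compl

theorem isOpen_layer {d : ℕ} (Ω : Set (EuclideanSpace ℝ (Fin d))) (δ : ℝ) :
    IsOpen (layer Ω δ) :=
  (isOpen_exterior Ω).inter (isOpen_lt (Metric.continuous_infDist_pt Ω) continuous_const)

theorem notMem_exterior {d : ℕ} {Ω : Set (EuclideanSpace ℝ (Fin d))}
    {x : EuclideanSpace ℝ (Fin d)} (hx : x ∈ Ω) : x ∉ exterior Ω :=
  fun h => h (subset_closure hx)

theorem measurableSet_norm_lt {d : ℕ} (δ : ℝ) :
    MeasurableSet {p : EuclideanSpace ℝ (Fin d) × EuclideanSpace ℝ (Fin d) |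
      ‖p.2 - p.1‖ < δ} :=
  measurableSet_lt (by fun_prop) measurable_const

theorem measurableSet_farPairs {d : ℕ} (Ω : Set (EuclideanSpace ℝ (Fin d))) (δ : ℝ) :
    MeasurableSet (farPairs Ω δ) :=
  ((isOpen_exterior Ω).measurableSet.prod (isOpen_exterior Ω).measurableSet).compl.inter
    (measurableSet_le measurable_const (by fun_prop))

theorem nearPairs_union_farPairs {d : ℕ} (Ω : Set (EuclideanSpace ℝ (Fin d))) (δ : ℝ) :
    nearPairs Ω δ ∪ farPairs Ω δ = (exterior Ω ×ˢ exterior Ω)ᶜ := by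
  ext p
  simp only [nearPairs, farPairs, Set.mem_union, Set.mem_inter_iff, Set.mem_ofPred_eq]
  have := lt_or_ge ‖p.2 - p.1‖ δ
  tauto

theorem disjoint_nearPairs_farPairs {d : ℕ} (Ω : Set (EuclideanSpace ℝ (Fin d))) (δ : ℝ) :
    Disjoint (nearPairs Ω δ) (farPairs Ω δ) :=
  Set.disjoint_left.2 fun p h1 h2 => absurd (show ‖p.2 - p.1‖ < δ from h1.2) (not_lt.2 h2.2)

theorem measurableSet_pairDomain {d : ℕ} {Ω : Set (EuclideanSpace ℝ (Fin d))} (hΩo : IsOpen Ω)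
    (δ : ℝ) : MeasurableSet (pairDomain Ω δ) := by
  have h1 : MeasurableSet (extDomain Ω δ) := (hΩo.union (isOpen_layer Ω δ)).measurableSet
  have h2 : MeasurableSet (layer Ω δ) := (isOpen_layer Ω δ).measurableSet
  exact (h1.prod h1).diff (h2.prod h2)

/-- If `∂Ω` is null, the interacting pairs at distance less than `δ` are, up to a null set, all
pairs at distance less than `δ` outside `Ω_c × Ω_c`: a point of `Ω_c` closer than `δ` to a point
of `Ω` lies in the interaction layer. -/
theorem pairDomain_inter_ae_eq_nearPairs {d : ℕ} {Ω : Set (EuclideanSpace ℝ (Fin d))}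
    (hΩo : IsOpen Ω) (hΩf : volume (frontier Ω) = 0) (δ : ℝ) :
    (pairDomain Ω δ ∩ {p | ‖p.2 - p.1‖ < δ} : Set _) =ᵐ[volume] nearPairs Ω δ := by
  have hU : ∀ᵐ x : EuclideanSpace ℝ (Fin d), x ∈ Ω ∨ x ∈ exterior Ω := by
    filter_upwards [compl_mem_ae_iff.2 hΩf] with x hx
    rw [hΩo.frontier_eq] at hx
    by_contra! h
    exact hx ⟨not_not.1 h.2, h.1⟩
  have h1 : ∀ᵐ p : EuclideanSpace ℝ (Fin d) × EuclideanSpace ℝ (Fin d),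
      p.1 ∈ Ω ∨ p.1 ∈ exterior Ω := Measure.quasiMeasurePreserving_fst.ae hU
  have h2 : ∀ᵐ p : EuclideanSpace ℝ (Fin d) × EuclideanSpace ℝ (Fin d),
      p.2 ∈ Ω ∨ p.2 ∈ exterior Ω := Measure.quasiMeasurePreserving_snd.ae hU
  rw [eventuallyEq_set]
  filter_upwards [h1, h2] with p hp1 hp2
  have e1 := @notMem_exterior d Ω p.1
  have e2 := @notMem_exterior d Ω p.2
  have l1 : p.2 ∈ Ω → ‖p.2 - p.1‖ < δ → Metric.infDist p.1 Ω < δ := fun h hlt =>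
    (Metric.infDist_le_dist_of_mem h).trans_lt (by rwa [dist_comm, dist_eq_norm])
  have l2 : p.1 ∈ Ω → ‖p.2 - p.1‖ < δ → Metric.infDist p.2 Ω < δ := fun h hlt =>
    (Metric.infDist_le_dist_of_mem h).trans_lt (by rwa [dist_eq_norm])
  simp only [pairDomain, nearPairs, extDomain, layer, Set.mem_inter_iff, Set.mem_sdiff,
    Set.mem_prod, Set.mem_union, Set.mem_ofPred_eq, Set.mem_compl_iff]
  by_cases p.1 ∈ Ω <;> by_cases p.2 ∈ Ω <;> by_cases ‖p.2 - p.1‖ < δ <;> simp_all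

theorem mul_truncKernel_eq_indicator {d : ℕ} (s δ : ℝ)
    (h : EuclideanSpace ℝ (Fin d) × EuclideanSpace ℝ (Fin d) → ℝ) :
    (fun p => h p * truncKernel s δ p.1 p.2) =
      Set.indicator {p | ‖p.2 - p.1‖ < δ} fun p => h p * fracKernel s p.1 p.2 := by
  ext p
  simp only [truncKernel, mem_ball_zero_iff, Set.indicator_apply, Set.mem_ofPred_eq, mul_ite,
    mul_zero]

theorem setIntegral_truncKernel {d : ℕ} {Ω : Set (EuclideanSpace ℝ (Fin d))}
    (hΩo : IsOpen Ω) (hΩf : volume (frontier Ω) = 0) (s δ : ℝ)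
    (h : EuclideanSpace ℝ (Fin d) × EuclideanSpace ℝ (Fin d) → ℝ) :
    ∫ p in pairDomain Ω δ, h p * truncKernel s δ p.1 p.2 =
      ∫ p in nearPairs Ω δ, h p * fracKernel s p.1 p.2 := by
  rw [mul_truncKernel_eq_indicator, setIntegral_indicator (measurableSet_norm_lt δ)]
  exact setIntegral_congr_set (pairDomain_inter_ae_eq_nearPairs hΩo hΩf δ)

theorem setLIntegral_truncKernel {d : ℕ} {Ω : Set (EuclideanSpace ℝ (Fin d))}
    (hΩo : IsOpen Ω) (hΩf : volume (frontier Ω) = 0) (s δ : ℝ)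
    (h : EuclideanSpace ℝ (Fin d) × EuclideanSpace ℝ (Fin d) → ℝ) :
    ∫⁻ p in pairDomain Ω δ, ENNReal.ofReal (h p * truncKernel s δ p.1 p.2) =
      ∫⁻ p in nearPairs Ω δ, ENNReal.ofReal (h p * fracKernel s p.1 p.2) := by
  have : (fun p => ENNReal.ofReal (h p * truncKernel s δ p.1 p.2)) =
      Set.indicator {p | ‖p.2 - p.1‖ < δ}
        fun p => ENNReal.ofReal (h p * fracKernel s p.1 p.2) := by
    ext p
    rw [congrFun (mul_truncKernel_eq_indicator s δ h) p]
    by_cases hp : p ∈ {p : EuclideanSpace ℝ (Fin d) × EuclideanSpace ℝ (Fin d) | ‖p.2 - p.1‖ < δ}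
    · rw [Set.indicator_of_mem hp, Set.indicator_of_mem hp]
    · rw [Set.indicator_of_notMem hp, Set.indicator_of_notMem hp, ENNReal.ofReal_zero]
  rw [this, setLIntegral_indicator (measurableSet_norm_lt δ), Set.inter_comm]
  exact setLIntegral_congr (pairDomain_inter_ae_eq_nearPairs hΩo hΩf δ)

/-! ### The energy density -/

/-- The energy density `(a(y) - a(x))² γ_s(x, y)` at the pair `(x, y)`. -/
noncomputable def energyDensity {d : ℕ} (s : ℝ) (a : EuclideanSpace ℝ (Fin d) → ℝ)
    (p : EuclideanSpace ℝ (Fin d) × EuclideanSpace ℝ (Fin d)) : ℝ :=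
  (a p.2 - a p.1) ^ 2 * fracKernel s p.1 p.2

theorem energyDensity_nonneg {d : ℕ} {s : ℝ} (hs0 : 0 < s) (hs1 : s < 1)
    (a : EuclideanSpace ℝ (Fin d) → ℝ)
    (p : EuclideanSpace ℝ (Fin d) × EuclideanSpace ℝ (Fin d)) : 0 ≤ energyDensity s a p :=
  mul_nonneg (sq_nonneg _) (fracKernel_nonneg hs0 hs1 _ _)

theorem aemeasurable_sub_prod {d : ℕ} {a : EuclideanSpace ℝ (Fin d) → ℝ} (ha : AEMeasurable a) :
    AEMeasurable fun p : EuclideanSpace ℝ (Fin d) × EuclideanSpace ℝ (Fin d) => a p.2 - a p.1 :=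
  (ha.comp_quasiMeasurePreserving Measure.quasiMeasurePreserving_snd).sub
    (ha.comp_quasiMeasurePreserving Measure.quasiMeasurePreserving_fst)

theorem aemeasurable_energyDensity {d : ℕ} (s : ℝ) {a : EuclideanSpace ℝ (Fin d) → ℝ}
    (ha : AEMeasurable a) : AEMeasurable (energyDensity s a) :=
  ((aemeasurable_sub_prod ha).pow_const 2).mul (measurable_fracKernel s).aemeasurable

theorem lintegral_fst_mul_sub {d : ℕ} {F k : EuclideanSpace ℝ (Fin d) → ℝ≥0∞}
    (hF : AEMeasurable F) (hk : Measurable k) :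
    ∫⁻ p : EuclideanSpace ℝ (Fin d) × EuclideanSpace ℝ (Fin d), F p.1 * k (p.2 - p.1) =
      (∫⁻ x, F x) * ∫⁻ z, k z := by
  have hm : AEMeasurable (fun p : EuclideanSpace ℝ (Fin d) × EuclideanSpace ℝ (Fin d) =>
      F p.1 * k (p.2 - p.1)) (volume.prod volume) :=
    (hF.comp_quasiMeasurePreserving Measure.quasiMeasurePreserving_fst).mul
      (hk.comp (measurable_snd.sub measurable_fst)).aemeasurable
  rw [Measure.volume_eq_prod, lintegral_prod _ hm, ← lintegral_mul_const'' _ hF]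
  refine lintegral_congr fun x => ?_
  have hkx : Measurable fun y => k (y - x) := hk.comp (measurable_id.sub_const x)
  dsimp only
  rw [lintegral_const_mul _ hkx, lintegral_sub_right_eq_self k x]

theorem lintegral_snd_mul_sub {d : ℕ} {F k : EuclideanSpace ℝ (Fin d) → ℝ≥0∞}
    (hF : AEMeasurable F) (hk : Measurable k) :
    ∫⁻ p : EuclideanSpace ℝ (Fin d) × EuclideanSpace ℝ (Fin d), F p.2 * k (p.2 - p.1) =
      (∫⁻ x, F x) * ∫⁻ z, k z := by
  have hm : AEMeasurable (fun p : EuclideanSpace ℝ (Fin d) × EuclideanSpace ℝ (Fin d) =>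
      F p.2 * k (p.2 - p.1)) (volume.prod volume) :=
    (hF.comp_quasiMeasurePreserving Measure.quasiMeasurePreserving_snd).mul
      (hk.comp (measurable_snd.sub measurable_fst)).aemeasurable
  rw [Measure.volume_eq_prod, lintegral_prod_symm _ hm, ← lintegral_mul_const'' _ hF]
  refine lintegral_congr fun y => ?_
  have hky : Measurable fun x => k (y - x) := hk.comp (measurable_const.sub measurable_id)
  dsimp only
  rw [lintegral_const_mul _ hky, lintegral_sub_left_eq_self k y]

/-- Far interactions are controlled by the `L²` norm alone. -/
theorem setLIntegral_energyDensity_farPairs_le {d : ℕ} {s : ℝ} (hs0 : 0 < s) (hs1 : s < 1)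
    (Ω : Set (EuclideanSpace ℝ (Fin d))) {δ : ℝ} (hδ : 1 ≤ δ)
    {v : EuclideanSpace ℝ (Fin d) → ℝ} (hv : AEMeasurable v) :
    ∫⁻ p in farPairs Ω δ, ENNReal.ofReal (energyDensity s v p) ≤
      4 * tailMass d s * ∫⁻ x, ENNReal.ofReal (v x ^ 2) := by
  have hSm : MeasurableSet {z : EuclideanSpace ℝ (Fin d) | 1 ≤ ‖z‖} :=
    measurableSet_le measurable_const measurable_norm
  obtain ⟨k, hk⟩ : ∃ k : EuclideanSpace ℝ (Fin d) → ℝ≥0∞,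
    k = Set.indicator {z | 1 ≤ ‖z‖} fun z => ENNReal.ofReal (fracKernel s 0 z) := ⟨_, rfl⟩
  have hkm : Measurable k := by
    have h0 : Measurable fun z : EuclideanSpace ℝ (Fin d) => fracKernel s 0 z := by
      unfold fracKernel
      fun_prop
    rw [hk]
    exact h0.ennreal_ofReal.indicator hSm
  have hkT : ∫⁻ z, k z = tailMass d s := by
    rw [hk, lintegral_indicator hSm, tailMass]
  obtain ⟨F, hF⟩ : ∃ F : EuclideanSpace ℝ (Fin d) → ℝ≥0∞,
    ∀ x, F x = ENNReal.ofReal (v x ^ 2) := ⟨_, fun _ => rfl⟩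
  have hFm : AEMeasurable F := by
    rw [funext hF]
    exact (hv.pow_const 2).ennreal_ofReal
  have hF1 : AEMeasurable fun p : EuclideanSpace ℝ (Fin d) × EuclideanSpace ℝ (Fin d) =>
      F p.1 * k (p.2 - p.1) :=
    (hFm.comp_quasiMeasurePreserving Measure.quasiMeasurePreserving_fst).mul
      (hkm.comp (measurable_snd.sub measurable_fst)).aemeasurable
  simp only [← hF]
  calc ∫⁻ p in farPairs Ω δ, ENNReal.ofReal (energyDensity s v p)
      ≤ ∫⁻ p in farPairs Ω δ, 2 * (F p.1 * k (p.2 - p.1) + F p.2 * k (p.2 - p.1)) := by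
        refine setLIntegral_mono' (measurableSet_farPairs Ω δ) fun p hp => ?_
        have hpS : p.2 - p.1 ∈ {z : EuclideanSpace ℝ (Fin d) | 1 ≤ ‖z‖} := hδ.trans hp.2
        have hker : fracKernel s 0 (p.2 - p.1) = fracKernel s p.1 p.2 := by
          rw [fracKernel, fracKernel, sub_zero]
        have hkp : k (p.2 - p.1) = ENNReal.ofReal (fracKernel s p.1 p.2) := by
          rw [hk, Set.indicator_of_mem hpS, hker]
        rw [hkp, hF, hF, ← add_mul, ← ENNReal.ofReal_add (sq_nonneg _) (sq_nonneg _),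
          ← ENNReal.ofReal_mul (by positivity), ← ENNReal.ofReal_ofNat 2,
          ← ENNReal.ofReal_mul (by norm_num), ← mul_assoc]
        refine ENNReal.ofReal_le_ofReal
          (mul_le_mul_of_nonneg_right ?_ (fracKernel_nonneg hs0 hs1 _ _))
        nlinarith [sq_nonneg (v p.2 + v p.1)]
    _ ≤ ∫⁻ p : EuclideanSpace ℝ (Fin d) × EuclideanSpace ℝ (Fin d),
          2 * (F p.1 * k (p.2 - p.1) + F p.2 * k (p.2 - p.1)) := setLIntegral_le_lintegral _ _
    _ = 4 * tailMass d s * ∫⁻ x, F x := by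
        rw [lintegral_const_mul' _ _ (by norm_num), lintegral_add_left' hF1,
          lintegral_fst_mul_sub hFm hkm, lintegral_snd_mul_sub hFm hkm, hkT]
        ring

/-- The constant in the nonlocal Poincaré inequality for functions supported in the ball of
radius `R` around the origin. -/
noncomputable def poincareConst (d : ℕ) (s R : ℝ) : ℝ≥0∞ :=
  ENNReal.ofReal (fracConst d s / (2 * R + 1) ^ ((d : ℝ) + 2 * s)) *
    volume {y : EuclideanSpace ℝ (Fin d) | R < ‖y‖ ∧ ‖y‖ < R + 1}

theorem poincareConst_pos {d : ℕ} (hd : 1 ≤ d) {s R : ℝ} (hs0 : 0 < s) (hs1 : s < 1)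
    (hR : 0 ≤ R) : 0 < poincareConst d s R := by
  have hC := fracConst_pos d hs0 hs1
  refine ENNReal.mul_pos (ENNReal.ofReal_pos.2 (by positivity)).ne' ?_
  have hopen : IsOpen {y : EuclideanSpace ℝ (Fin d) | R < ‖y‖ ∧ ‖y‖ < R + 1} :=
    (isOpen_lt continuous_const continuous_norm).inter
      (isOpen_lt continuous_norm continuous_const)
  refine (hopen.measure_pos volume ?_).ne'
  have : Nontrivial (EuclideanSpace ℝ (Fin d)) := by
    apply Module.nontrivial_of_finrank_pos (R := ℝ)
    rw [finrank_euclideanSpace_fin]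
    omega
  obtain ⟨y, hy⟩ := exists_norm_eq (EuclideanSpace ℝ (Fin d)) (by linarith : 0 ≤ R + 1 / 2)
  exact ⟨y, by rw [hy]; linarith, by rw [hy]; linarith⟩

theorem poincareConst_lt_top (d : ℕ) (s R : ℝ) : poincareConst d s R < ∞ := by
  refine ENNReal.mul_lt_top ENNReal.ofReal_lt_top ?_
  refine (measure_mono fun y hy => ?_).trans_lt
    (measure_ball_lt_top (x := (0 : EuclideanSpace ℝ (Fin d))) (r := R + 1))
  exact mem_ball_zero_iff.2 hy.2

/-- Nonlocal Poincaré inequality: every point of `Ω` interacts with an annulus around `Ω`, where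
`v` vanishes. -/
theorem poincareConst_mul_le {d : ℕ} {s R δ : ℝ} (hs0 : 0 < s) (hs1 : s < 1) (hR : 0 ≤ R)
    {Ω : Set (EuclideanSpace ℝ (Fin d))} (hΩR : Ω ⊆ Metric.closedBall 0 R) (hΩm : MeasurableSet Ω)
    (hδ : 2 * R + 1 ≤ δ) {v : EuclideanSpace ℝ (Fin d) → ℝ} (hv : AEMeasurable v)
    (hv0 : ∀ x, x ∉ Ω → v x = 0) :
    poincareConst d s R * ∫⁻ x in Ω, ENNReal.ofReal (v x ^ 2) ≤
      ∫⁻ p in nearPairs Ω δ, ENNReal.ofReal (energyDensity s v p) := by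
  set A : Set (EuclideanSpace ℝ (Fin d)) := {y | R < ‖y‖ ∧ ‖y‖ < R + 1}
  have hAm : MeasurableSet A := (measurableSet_lt measurable_const measurable_norm).inter
      (measurableSet_lt measurable_norm measurable_const)
  have hAΩ : ∀ y ∈ A, y ∉ Ω := fun y hy h =>
    absurd (mem_closedBall_zero_iff.1 (hΩR h)) (not_le.2 hy.1)
  have hC := fracConst_pos d hs0 hs1
  set c : ℝ := fracConst d s / (2 * R + 1) ^ ((d : ℝ) + 2 * s)
  have hc0 : 0 ≤ c := by positivity
  have hdist : ∀ p ∈ Ω ×ˢ A, ‖p.2 - p.1‖ < 2 * R + 1 := fun p hp => by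
    have := norm_sub_le p.2 p.1
    have := mem_closedBall_zero_iff.1 (hΩR hp.1)
    have := hp.2.2
    linarith
  have hsub : Ω ×ˢ A ⊆ nearPairs Ω δ := fun p hp =>
    ⟨fun h => notMem_exterior hp.1 h.1, (hdist p hp).trans_le hδ⟩
  refine le_trans ?_ (lintegral_mono_set hsub)
  calc poincareConst d s R * ∫⁻ x in Ω, ENNReal.ofReal (v x ^ 2)
      = ∫⁻ p in Ω ×ˢ A, ENNReal.ofReal (v p.1 ^ 2) * ENNReal.ofReal c := by
        rw [Measure.volume_eq_prod, ← Measure.prod_restrict,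
          lintegral_prod_mul (g := fun _ => ENNReal.ofReal c)
            (hv.restrict.pow_const 2).ennreal_ofReal aemeasurable_const,
          setLIntegral_const, poincareConst]
        ring
    _ ≤ ∫⁻ p in Ω ×ˢ A, ENNReal.ofReal (energyDensity s v p) := by
        refine setLIntegral_mono' (hΩm.prod hAm) fun p hp => ?_
        rw [← ENNReal.ofReal_mul (sq_nonneg _), energyDensity, hv0 _ (hAΩ _ hp.2), zero_sub, neg_sq]
        refine ENNReal.ofReal_le_ofReal (mul_le_mul_of_nonneg_left ?_ (sq_nonneg _))
        have hne : 0 < ‖p.2 - p.1‖ :=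
          norm_pos_iff.2 (sub_ne_zero.2 fun h => hAΩ _ hp.2 (h ▸ hp.1))
        exact div_le_div_of_nonneg_left hC.le (by positivity)
          (Real.rpow_le_rpow hne.le (hdist p hp).le (by positivity))

/-! ### Functions of finite energy -/

theorem lintegral_energyDensity {d : ℕ} {s : ℝ} (hs0 : 0 < s) (hs1 : s < 1)
    (μ : Measure (EuclideanSpace ℝ (Fin d) × EuclideanSpace ℝ (Fin d)))
    (a : EuclideanSpace ℝ (Fin d) → ℝ) :
    ∫⁻ p, ENNReal.ofReal (energyDensity s a p) ∂μ =
      ENNReal.ofReal (fracConst d s) * ∫⁻ p,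
        ENNReal.ofReal ((a p.2 - a p.1) ^ 2 / ‖p.2 - p.1‖ ^ ((d : ℝ) + 2 * s)) ∂μ := by
  rw [← lintegral_const_mul' _ _ ENNReal.ofReal_ne_top]
  refine lintegral_congr fun p => ?_
  rw [← ENNReal.ofReal_mul (fracConst_pos d hs0 hs1).le, energyDensity, fracKernel]
  congr 1
  ring

theorem memHs_univ_iff {d : ℕ} {s : ℝ} (hs0 : 0 < s) (hs1 : s < 1)
    {a : EuclideanSpace ℝ (Fin d) → ℝ} :
    MemHs s Set.univ a ↔ AEMeasurable a ∧ ∫⁻ x, ENNReal.ofReal (a x ^ 2) < ∞ ∧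
      ∫⁻ p, ENNReal.ofReal (energyDensity s a p) < ∞ := by
  have hC : ENNReal.ofReal (fracConst d s) ≠ 0 :=
    (ENNReal.ofReal_pos.2 (fracConst_pos d hs0 hs1)).ne'
  rw [MemHs, HsNorm, ENNReal.rpow_lt_top_iff_of_pos (by norm_num), ENNReal.add_lt_top,
    Set.univ_prod_univ, Measure.restrict_univ, Measure.restrict_univ,
    aestronglyMeasurable_iff_aemeasurable, lintegral_energyDensity hs0 hs1]
  refine and_congr_right fun _ => and_congr_right fun _ => ⟨fun h => ?_, fun h => ?_⟩
  · exact ENNReal.mul_lt_top ENNReal.ofReal_lt_top h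
  · exact ENNReal.lt_top_of_mul_ne_top_right h.ne hC

theorem integrable_energyDensity {d : ℕ} {s : ℝ} (hs0 : 0 < s) (hs1 : s < 1)
    {a : EuclideanSpace ℝ (Fin d) → ℝ} (ha : MemHs s Set.univ a) :
    Integrable (energyDensity s a) := by
  obtain ⟨hm, -, hE⟩ := (memHs_univ_iff hs0 hs1).1 ha
  refine ⟨(aemeasurable_energyDensity s hm).aestronglyMeasurable, ?_⟩
  rwa [hasFiniteIntegral_iff_ofReal (ae_of_all _ (energyDensity_nonneg hs0 hs1 a))]

theorem integrable_mixed {d : ℕ} {s : ℝ} (hs0 : 0 < s) (hs1 : s < 1)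
    {a b : EuclideanSpace ℝ (Fin d) → ℝ} (ha : MemHs s Set.univ a) (hb : MemHs s Set.univ b) :
    Integrable fun p : EuclideanSpace ℝ (Fin d) × EuclideanSpace ℝ (Fin d) =>
      (b p.2 - b p.1) * (a p.2 - a p.1) * fracKernel s p.1 p.2 := by
  refine ((integrable_energyDensity hs0 hs1 ha).add (integrable_energyDensity hs0 hs1 hb)).mono'
    ?_ (ae_of_all _ fun p => ?_)
  · exact (((aemeasurable_sub_prod ((memHs_univ_iff hs0 hs1).1 hb).1).mul
      (aemeasurable_sub_prod ((memHs_univ_iff hs0 hs1).1 ha).1)).mul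
      (measurable_fracKernel s).aemeasurable).aestronglyMeasurable
  · have hk := fracKernel_nonneg hs0 hs1 p.1 p.2
    rw [Pi.add_apply, energyDensity, energyDensity, ← add_mul, norm_mul, Real.norm_of_nonneg hk]
    refine mul_le_mul_of_nonneg_right ?_ hk
    rw [Real.norm_eq_abs]
    refine abs_le.2 ⟨?_, ?_⟩
    · nlinarith [sq_nonneg (a p.2 - a p.1 + (b p.2 - b p.1)),
        sq_nonneg (a p.2 - a p.1), sq_nonneg (b p.2 - b p.1)]
    · nlinarith [sq_nonneg (a p.2 - a p.1 - (b p.2 - b p.1)),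
        sq_nonneg (a p.2 - a p.1), sq_nonneg (b p.2 - b p.1)]

theorem ofReal_sub_sq_mul_le (a b : ℝ) {k : ℝ} (hk : 0 ≤ k) :
    ENNReal.ofReal ((a - b) ^ 2 * k) ≤
      2 * ENNReal.ofReal (a ^ 2 * k) + 2 * ENNReal.ofReal (b ^ 2 * k) := by
  rw [← mul_add, ← ENNReal.ofReal_add (by positivity) (by positivity), ← ENNReal.ofReal_ofNat 2,
    ← ENNReal.ofReal_mul (by norm_num), ← add_mul, ← mul_assoc]
  refine ENNReal.ofReal_le_ofReal (mul_le_mul_of_nonneg_right ?_ hk)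
  nlinarith [sq_nonneg (a + b)]

theorem truncKernel_nonneg {d : ℕ} {s : ℝ} (hs0 : 0 < s) (hs1 : s < 1) (δ : ℝ)
    (x y : EuclideanSpace ℝ (Fin d)) : 0 ≤ truncKernel s δ x y := by
  unfold truncKernel
  split_ifs
  exacts [fracKernel_nonneg hs0 hs1 x y, le_rfl]

theorem memV_iff {d : ℕ} {s δ : ℝ} {Ω : Set (EuclideanSpace ℝ (Fin d))}
    {a : EuclideanSpace ℝ (Fin d) → ℝ} :
    MemV s Ω δ a ↔ AEMeasurable a (volume.restrict (extDomain Ω δ)) ∧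
      ∫⁻ p in pairDomain Ω δ, ENNReal.ofReal ((a p.2 - a p.1) ^ 2 * truncKernel s δ p.1 p.2) < ∞ ∧
      ∫⁻ x in extDomain Ω δ, ENNReal.ofReal (a x ^ 2) < ∞ := by
  rw [MemV, energyNorm, ENNReal.rpow_lt_top_iff_of_pos (by norm_num), ENNReal.add_lt_top,
    aestronglyMeasurable_iff_aemeasurable]
  refine and_congr_right fun _ => and_congr_left fun _ => ⟨fun h => ?_, fun h => ?_⟩
  · exact ENNReal.lt_top_of_mul_ne_top_right h.ne (by norm_num)
  · exact ENNReal.mul_lt_top (by norm_num) h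

/-! ### The error as a test function -/

section Error

variable {d : ℕ} {s δ : ℝ} {Ω : Set (EuclideanSpace ℝ (Fin d))}
  {w a b : EuclideanSpace ℝ (Fin d) → ℝ}

/-- The two solutions agree on the interaction layer, so on interacting pairs the increments of
the error, extended by zero, are the differences of the increments of the solutions. -/
theorem ae_indicator_sub_increment (hΩo : IsOpen Ω)
    (ha : ∀ᵐ x ∂volume.restrict (layer Ω δ), a x = w x)
    (hb : ∀ᵐ x ∂volume.restrict (exterior Ω), b x = w x) :
    ∀ᵐ p ∂volume.restrict (pairDomain Ω δ),
      Ω.indicator (a - b) p.2 - Ω.indicator (a - b) p.1 =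
        (a p.2 - a p.1) - (b p.2 - b p.1) := by
  have key : ∀ᵐ x : EuclideanSpace ℝ (Fin d),
      x ∈ extDomain Ω δ → Ω.indicator (a - b) x = a x - b x := by
    filter_upwards [(ae_restrict_iff' (isOpen_layer Ω δ).measurableSet).1 ha,
      (ae_restrict_iff' (isOpen_exterior Ω).measurableSet).1 hb] with x hax hbx hx
    by_cases hxΩ : x ∈ Ω
    · rw [Set.indicator_of_mem hxΩ, Pi.sub_apply]
    · have hxl := hx.resolve_left hxΩ
      rw [Set.indicator_of_notMem hxΩ, hax hxl, hbx hxl.1, sub_self]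
  have k1 : ∀ᵐ p : EuclideanSpace ℝ (Fin d) × EuclideanSpace ℝ (Fin d),
      p.1 ∈ extDomain Ω δ → Ω.indicator (a - b) p.1 = a p.1 - b p.1 :=
    Measure.quasiMeasurePreserving_fst.ae key
  have k2 : ∀ᵐ p : EuclideanSpace ℝ (Fin d) × EuclideanSpace ℝ (Fin d),
      p.2 ∈ extDomain Ω δ → Ω.indicator (a - b) p.2 = a p.2 - b p.2 :=
    Measure.quasiMeasurePreserving_snd.ae key
  rw [ae_restrict_iff' (measurableSet_pairDomain hΩo δ)]
  filter_upwards [k1, k2] with p h1 h2 hp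
  rw [h1 hp.1.1, h2 hp.1.2]
  ring

/-- The error, extended by zero, is admissible in both weak formulations. -/
theorem memVc_and_memHsc_error (hs0 : 0 < s) (hs1 : s < 1) (hΩo : IsOpen Ω)
    (hΩf : volume (frontier Ω) = 0) (hδ : 1 ≤ δ)
    (ha : MemV s Ω δ a) (hb : MemHs s Set.univ b)
    (haw : ∀ᵐ x ∂volume.restrict (layer Ω δ), a x = w x)
    (hbw : ∀ᵐ x ∂volume.restrict (exterior Ω), b x = w x) :
    MemVc s Ω δ (Ω.indicator (a - b)) ∧ MemHsc s Ω (Ω.indicator (a - b)) := by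
  obtain ⟨ham, haE, haL⟩ := memV_iff.1 ha
  obtain ⟨hbm, hbL, hbE⟩ := (memHs_univ_iff hs0 hs1).1 hb
  have hΩm : MeasurableSet Ω := hΩo.measurableSet
  have hsub : Ω ⊆ extDomain Ω δ := Set.subset_union_left
  have hvm : AEMeasurable (Ω.indicator (a - b)) := by
    rw [aemeasurable_indicator_iff hΩm]
    exact (ham.mono_measure (Measure.restrict_mono hsub le_rfl)).sub hbm.restrict
  have hv0 : ∀ x, x ∉ Ω → Ω.indicator (a - b) x = 0 := fun x hx => Set.indicator_of_notMem hx _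
  have hvL : ∫⁻ x, ENNReal.ofReal (Ω.indicator (a - b) x ^ 2) < ∞ := by
    have h1 : ∫⁻ x, ENNReal.ofReal (Ω.indicator (a - b) x ^ 2) ≤
        ∫⁻ x in Ω, (2 * ENNReal.ofReal (a x ^ 2) + 2 * ENNReal.ofReal (b x ^ 2)) := by
      rw [← lintegral_indicator hΩm]
      refine lintegral_mono fun x => ?_
      by_cases hx : x ∈ Ω
      · rw [Set.indicator_of_mem hx, Set.indicator_of_mem hx]
        simpa using ofReal_sub_sq_mul_le (a x) (b x) zero_le_one
      · rw [Set.indicator_of_notMem hx, Set.indicator_of_notMem hx]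
        simp
    refine h1.trans_lt ?_
    rw [lintegral_add_right' _ ((hbm.restrict.pow_const 2).ennreal_ofReal.const_mul _),
      lintegral_const_mul' _ _ (by norm_num), lintegral_const_mul' _ _ (by norm_num)]
    exact ENNReal.add_lt_top.2 ⟨ENNReal.mul_lt_top (by norm_num)
      ((lintegral_mono_set hsub).trans_lt haL), ENNReal.mul_lt_top (by norm_num)
      ((setLIntegral_le_lintegral _ _).trans_lt hbL)⟩
  have hvP : ∫⁻ p in pairDomain Ω δ, ENNReal.ofReal
      ((Ω.indicator (a - b) p.2 - Ω.indicator (a - b) p.1) ^ 2 * truncKernel s δ p.1 p.2) < ∞ := by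
    have h1 : ∫⁻ p in pairDomain Ω δ, ENNReal.ofReal
        ((Ω.indicator (a - b) p.2 - Ω.indicator (a - b) p.1) ^ 2 * truncKernel s δ p.1 p.2) ≤
        ∫⁻ p in pairDomain Ω δ,
          (2 * ENNReal.ofReal ((a p.2 - a p.1) ^ 2 * truncKernel s δ p.1 p.2) +
            2 * ENNReal.ofReal (energyDensity s b p)) := by
      refine lintegral_mono_ae ?_
      filter_upwards [ae_indicator_sub_increment hΩo haw hbw] with p hp
      rw [hp]
      refine (ofReal_sub_sq_mul_le _ _ (truncKernel_nonneg hs0 hs1 δ _ _)).trans ?_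
      gcongr
      refine mul_le_mul_of_nonneg_left ?_ (sq_nonneg _)
      unfold truncKernel
      split_ifs
      exacts [le_rfl, fracKernel_nonneg hs0 hs1 _ _]
    refine h1.trans_lt ?_
    rw [lintegral_add_right' _
      ((aemeasurable_energyDensity s hbm).restrict.ennreal_ofReal.const_mul _),
      lintegral_const_mul' _ _ (by norm_num), lintegral_const_mul' _ _ (by norm_num)]
    exact ENNReal.add_lt_top.2 ⟨ENNReal.mul_lt_top (by norm_num) haE,
      ENNReal.mul_lt_top (by norm_num) ((setLIntegral_le_lintegral _ _).trans_lt hbE)⟩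
  have hvE : ∫⁻ p, ENNReal.ofReal (energyDensity s (Ω.indicator (a - b)) p) < ∞ := by
    -- pairs in `Ω_c × Ω_c` do not contribute, since the extended error vanishes off `Ω`
    have h0 : ∫⁻ p, ENNReal.ofReal (energyDensity s (Ω.indicator (a - b)) p) =
        ∫⁻ p in (exterior Ω ×ˢ exterior Ω)ᶜ,
          ENNReal.ofReal (energyDensity s (Ω.indicator (a - b)) p) := by
      refine (setLIntegral_eq_of_support_subset fun p hp => ?_).symm
      rintro ⟨hp1, hp2⟩
      refine hp ?_
      dsimp only
      rw [energyDensity, hv0 _ fun h => notMem_exterior h hp1,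
        hv0 _ fun h => notMem_exterior h hp2]
      simp
    rw [h0, ← nearPairs_union_farPairs Ω δ]
    refine (lintegral_union_le _ _ _).trans_lt (ENNReal.add_lt_top.2 ⟨?_, ?_⟩)
    · rw [setLIntegral_truncKernel hΩo hΩf] at hvP
      exact hvP
    · exact (setLIntegral_energyDensity_farPairs_le hs0 hs1 Ω hδ hvm).trans_lt
        (ENNReal.mul_lt_top (ENNReal.mul_lt_top (by norm_num) (tailMass_lt_top d hs0 hs1)) hvL)
  have hvext : ∀ᵐ x ∂volume.restrict (exterior Ω), Ω.indicator (a - b) x = 0 := by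
    rw [ae_restrict_iff' (isOpen_exterior Ω).measurableSet]
    exact ae_of_all _ fun x hx => hv0 x fun h => notMem_exterior h hx
  refine ⟨⟨memV_iff.2 ⟨hvm.restrict, hvP, (setLIntegral_le_lintegral _ _).trans_lt hvL⟩, ?_⟩,
    (memHs_univ_iff hs0 hs1).2 ⟨hvm, hvL, hvE⟩, hvext⟩
  exact ae_restrict_of_ae_restrict_of_subset (fun x hx => hx.1) hvext

/-- Testing both equations with the error: its near energy equals the far interaction of the
error with the fractional solution, the only part of the fractional form that the truncated
kernel does not see. -/
theorem setIntegral_energyDensity_error (hs0 : 0 < s) (hs1 : s < 1) (hΩo : IsOpen Ω)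
    (hΩf : volume (frontier Ω) = 0) (hδ : 1 ≤ δ) {f : (Ω → ℝ) →ₗ[ℝ] ℝ}
    (ha : IsNonlocalSolution s Ω δ f w a) (hb : IsFractionalSolution s Ω f w b) :
    ∫ p in nearPairs Ω δ, energyDensity s (Ω.indicator (a - b)) p =
      ∫ p in farPairs Ω δ, (Ω.indicator (a - b) p.2 - Ω.indicator (a - b) p.1) *
        (b p.2 - b p.1) * fracKernel s p.1 p.2 := by
  obtain ⟨hVc, hHsc⟩ := memVc_and_memHsc_error hs0 hs1 hΩo hΩf hδ ha.mem hb.mem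
    ha.dirichlet hb.dirichlet
  have hweak := (ha.weak _ hVc).trans (hb.weak _ hHsc).symm
  have hmix := integrable_mixed hs0 hs1 hb.mem hHsc.1
  have hen := integrable_energyDensity hs0 hs1 hHsc.1
  have hincr := ae_indicator_sub_increment hΩo ha.dirichlet hb.dirichlet
  set v := Ω.indicator (a - b)
  have h1 : nonlocalForm s Ω δ a v = 2⁻¹ * ((∫ p in nearPairs Ω δ, energyDensity s v p) +
      ∫ p in nearPairs Ω δ, (v p.2 - v p.1) * (b p.2 - b p.1) * fracKernel s p.1 p.2) := by
    rw [nonlocalForm, ← integral_add hen.integrableOn hmix.integrableOn]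
    congr 1
    calc ∫ p in pairDomain Ω δ, (v p.2 - v p.1) * (a p.2 - a p.1) * truncKernel s δ p.1 p.2
        = ∫ p in pairDomain Ω δ, (v p.2 - v p.1) * ((v p.2 - v p.1) + (b p.2 - b p.1)) *
            truncKernel s δ p.1 p.2 := by
          refine integral_congr_ae ?_
          filter_upwards [hincr] with p hp
          rw [show a p.2 - a p.1 = (v p.2 - v p.1) + (b p.2 - b p.1) by rw [hp]; ring]
      _ = ∫ p in nearPairs Ω δ, (v p.2 - v p.1) * ((v p.2 - v p.1) + (b p.2 - b p.1)) *
            fracKernel s p.1 p.2 := setIntegral_truncKernel hΩo hΩf s δ _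
      _ = _ := by
          refine integral_congr_ae (ae_of_all _ fun p => ?_)
          simp only [energyDensity]
          ring
  have h2 : fractionalForm s Ω b v =
      2⁻¹ * ((∫ p in nearPairs Ω δ, (v p.2 - v p.1) * (b p.2 - b p.1) * fracKernel s p.1 p.2) +
        ∫ p in farPairs Ω δ, (v p.2 - v p.1) * (b p.2 - b p.1) * fracKernel s p.1 p.2) := by
    rw [fractionalForm, ← nearPairs_union_farPairs Ω δ,
      setIntegral_union (disjoint_nearPairs_farPairs Ω δ) (measurableSet_farPairs Ω δ)
        hmix.integrableOn hmix.integrableOn]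
  rw [h1, h2] at hweak
  linarith

end Error

/-! ### The error estimate -/

/-- Absorption: with `e = c / (8 (T + 1))` the first term is at most `E / 2`. -/
theorem le_of_forall_young {E L T c M : ℝ} (hT : 0 ≤ T) (hc : 0 < c) (hE : 0 ≤ E)
    (hcL : c * L ≤ E) (h : ∀ e > 0, E ≤ e * (4 * T * L) + (4 * e)⁻¹ * M) :
    E ≤ 4 * (T + 1) / c * M := by
  have h1 := h (c / (8 * (T + 1))) (by positivity)
  have e1 : c / (8 * (T + 1)) * (4 * T * L) = T / (2 * (T + 1)) * (c * L) := by
    field_simp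
    ring
  have e2 : (4 * (c / (8 * (T + 1))))⁻¹ * M = 4 * (T + 1) / c * M / 2 := by
    field_simp
    ring
  have e3 : T / (2 * (T + 1)) * (c * L) ≤ 1 / 2 * E := by
    refine (mul_le_mul_of_nonneg_left hcL (by positivity)).trans
      (mul_le_mul_of_nonneg_right ?_ hE)
    rw [div_le_div_iff₀ (by positivity) (by positivity)]
    linarith
  rw [e1, e2] at h1
  linarith

/-- The near energy of the error is at most a constant, independent of `δ`, times the far energy
of the fractional solution. -/
theorem setLIntegral_energyDensity_error_le {d : ℕ} (hd : 1 ≤ d) {s δ R : ℝ} (hs0 : 0 < s)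
    (hs1 : s < 1) {Ω : Set (EuclideanSpace ℝ (Fin d))} (hΩo : IsOpen Ω)
    (hΩf : volume (frontier Ω) = 0) (hR : 0 ≤ R) (hΩR : Ω ⊆ Metric.closedBall 0 R)
    (hδ : 2 * R + 1 ≤ δ) {w a b : EuclideanSpace ℝ (Fin d) → ℝ} {f : (Ω → ℝ) →ₗ[ℝ] ℝ}
    (ha : IsNonlocalSolution s Ω δ f w a) (hb : IsFractionalSolution s Ω f w b) :
    ∫⁻ p in nearPairs Ω δ, ENNReal.ofReal (energyDensity s (Ω.indicator (a - b)) p) ≤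
      ENNReal.ofReal (4 * ((tailMass d s).toReal + 1) / (poincareConst d s R).toReal *
        ∫ p in farPairs Ω δ, energyDensity s b p) := by
  have hδ1 : 1 ≤ δ := by linarith
  have hident := setIntegral_energyDensity_error hs0 hs1 hΩo hΩf hδ1 ha hb
  have hHs := (memVc_and_memHsc_error hs0 hs1 hΩo hΩf hδ1 ha.mem hb.mem
    ha.dirichlet hb.dirichlet).2.1
  have hv0 : ∀ x, x ∉ Ω → Ω.indicator (a - b) x = 0 := fun x hx => Set.indicator_of_notMem hx _
  set v := Ω.indicator (a - b)
  obtain ⟨hvm, hvL, -⟩ := (memHs_univ_iff hs0 hs1).1 hHs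
  have hen := integrable_energyDensity hs0 hs1 hHs
  have henb := integrable_energyDensity hs0 hs1 hb.mem
  have hmix := integrable_mixed hs0 hs1 hb.mem hHs
  have hnn : ∀ (S : Set (EuclideanSpace ℝ (Fin d) × EuclideanSpace ℝ (Fin d))),
      ENNReal.ofReal (∫ p in S, energyDensity s v p) =
        ∫⁻ p in S, ENNReal.ofReal (energyDensity s v p) := fun S =>
    ofReal_integral_eq_lintegral_ofReal hen.integrableOn
      (ae_of_all _ (energyDensity_nonneg hs0 hs1 v))
  have hLΩ : ∫⁻ x in Ω, ENNReal.ofReal (v x ^ 2) = ∫⁻ x, ENNReal.ofReal (v x ^ 2) := by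
    refine setLIntegral_eq_of_support_subset fun x hx => ?_
    by_contra h
    exact hx (by simp [hv0 x h])
  have hE0 : 0 ≤ ∫ p in nearPairs Ω δ, energyDensity s v p :=
    integral_nonneg (energyDensity_nonneg hs0 hs1 v)
  rw [← hnn]
  refine ENNReal.ofReal_le_ofReal (le_of_forall_young
    (L := (∫⁻ x, ENNReal.ofReal (v x ^ 2)).toReal) ENNReal.toReal_nonneg
    (ENNReal.toReal_pos (poincareConst_pos hd hs0 hs1 hR).ne' (poincareConst_lt_top d s R).ne)
    hE0 ?_ ?_)
  · rw [← ENNReal.toReal_mul, ← hLΩ]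
    refine ENNReal.toReal_le_of_le_ofReal hE0 ?_
    rw [hnn]
    exact poincareConst_mul_le hs0 hs1 hR hΩR hΩo.measurableSet hδ hvm hv0
  · intro e he
    have hfar : ∫ p in farPairs Ω δ, energyDensity s v p ≤
        4 * (tailMass d s).toReal * (∫⁻ x, ENNReal.ofReal (v x ^ 2)).toReal := by
      have hfin : 4 * tailMass d s * ∫⁻ x, ENNReal.ofReal (v x ^ 2) ≠ ∞ :=
        (ENNReal.mul_lt_top (ENNReal.mul_lt_top (by norm_num) (tailMass_lt_top d hs0 hs1)) hvL).ne
      have h := setLIntegral_energyDensity_farPairs_le hs0 hs1 Ω hδ1 hvm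
      rw [← hnn, ENNReal.ofReal_le_iff_le_toReal hfin, ENNReal.toReal_mul, ENNReal.toReal_mul] at h
      simpa using h
    rw [hident]
    refine le_trans ?_ (add_le_add_left (mul_le_mul_of_nonneg_left hfar he.le) _)
    rw [← integral_const_mul, ← integral_const_mul,
      ← integral_add (hen.integrableOn.const_mul e) (henb.integrableOn.const_mul _)]
    refine integral_mono hmix.integrableOn
      ((hen.integrableOn.const_mul e).add (henb.integrableOn.const_mul _)) fun p => ?_
    simp only [energyDensity]
    rw [← mul_assoc, ← mul_assoc, ← add_mul]
    refine mul_le_mul_of_nonneg_right ?_ (fracKernel_nonneg hs0 hs1 _ _)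
    -- Young's inequality `x y ≤ e x² + y² / (4 e)`
    have hsq : e * (v p.2 - v p.1) ^ 2 + (4 * e)⁻¹ * (b p.2 - b p.1) ^ 2 -
        (v p.2 - v p.1) * (b p.2 - b p.1) =
        e * (v p.2 - v p.1 - (2 * e)⁻¹ * (b p.2 - b p.1)) ^ 2 := by
      field_simp
      ring
    have : 0 ≤ e * (v p.2 - v p.1 - (2 * e)⁻¹ * (b p.2 - b p.1)) ^ 2 := by positivity
    linarith

/-- The `H^s(Ω)` norm of a difference is controlled by the near energy of its extension by
zero. -/
theorem HsNorm_sub_le {d : ℕ} (hd : 1 ≤ d) {s δ R : ℝ} (hs0 : 0 < s) (hs1 : s < 1)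
    {Ω : Set (EuclideanSpace ℝ (Fin d))} (hΩm : MeasurableSet Ω) (hR : 0 ≤ R)
    (hΩR : Ω ⊆ Metric.closedBall 0 R) (hδ : 2 * R + 1 ≤ δ)
    {u : EuclideanSpace ℝ (Fin d) → ℝ} (hv : AEMeasurable (Ω.indicator u)) :
    HsNorm s Ω u ≤ (((poincareConst d s R)⁻¹ + (ENNReal.ofReal (fracConst d s))⁻¹) *
      ∫⁻ p in nearPairs Ω δ, ENNReal.ofReal (energyDensity s (Ω.indicator u) p)) ^
        (1 / 2 : ℝ) := by
  rw [HsNorm, add_mul]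
  refine ENNReal.rpow_le_rpow (add_le_add ?_ ?_) (by norm_num)
  · rw [mul_comm, ← div_eq_mul_inv, ENNReal.le_div_iff_mul_le
      (Or.inl (poincareConst_pos hd hs0 hs1 hR).ne') (Or.inl (poincareConst_lt_top d s R).ne),
      mul_comm]
    refine le_trans (le_of_eq ?_) (poincareConst_mul_le hs0 hs1 hR hΩR hΩm hδ hv
      fun x hx => Set.indicator_of_notMem hx _)
    congr 1
    refine setLIntegral_congr_fun hΩm fun x hx => ?_
    simp only [Set.indicator_of_mem hx]
  · rw [mul_comm (ENNReal.ofReal _)⁻¹, ← div_eq_mul_inv, ENNReal.le_div_iff_mul_le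
      (Or.inl (ENNReal.ofReal_pos.2 (fracConst_pos d hs0 hs1)).ne')
      (Or.inl ENNReal.ofReal_ne_top), mul_comm _ (ENNReal.ofReal _),
      ← lintegral_energyDensity hs0 hs1]
    have hsub : Ω ×ˢ Ω ⊆ nearPairs Ω δ := fun p hp => by
      refine ⟨fun h => notMem_exterior hp.1 h.1, ?_⟩
      have h1 := mem_closedBall_zero_iff.1 (hΩR hp.1)
      have h2 := mem_closedBall_zero_iff.1 (hΩR hp.2)
      have h3 := norm_sub_le p.2 p.1
      exact (by linarith : ‖p.2 - p.1‖ < δ)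
    refine le_trans (le_of_eq ?_) (lintegral_mono_set hsub)
    refine setLIntegral_congr_fun (hΩm.prod hΩm) fun p hp => ?_
    simp only [energyDensity, Set.indicator_of_mem hp.1, Set.indicator_of_mem hp.2]

theorem tendsto_setIntegral_energyDensity_farPairs {d : ℕ} {s : ℝ} (hs0 : 0 < s) (hs1 : s < 1)
    (Ω : Set (EuclideanSpace ℝ (Fin d))) {b : EuclideanSpace ℝ (Fin d) → ℝ}
    (hb : MemHs s Set.univ b) :
    Tendsto (fun δ : ℝ => ∫ p in farPairs Ω δ, energyDensity s b p) atTop (𝓝 0) := by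
  have h := tendsto_setIntegral_of_antitone (measurableSet_farPairs Ω)
    (fun δ₁ δ₂ hδ p hp => ⟨hp.1, hδ.trans hp.2⟩ : Antitone (farPairs Ω))
    ⟨0, (integrable_energyDensity hs0 hs1 hb).integrableOn⟩
  have hempty : ⋂ δ : ℝ, farPairs Ω δ = ∅ := by
    refine Set.eq_empty_iff_forall_notMem.2 fun p hp => ?_
    have h1 : ‖p.2 - p.1‖ + 1 ≤ ‖p.2 - p.1‖ := (Set.mem_iInter.1 hp (‖p.2 - p.1‖ + 1)).2
    linarith
  rwa [hempty, setIntegral_empty] at h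

end NonlocalDiffusion

theorem mainTheorem4 {d : ℕ} (hd : 1 ≤ d) (s : ℝ) (hs0 : 0 < s) (hs1 : s < 1)
    (Ω : Set (EuclideanSpace ℝ (Fin d))) (hΩo : IsOpen Ω) (hΩb : Bornology.IsBounded Ω)
    (hΩL : NonlocalDiffusion.HasLipschitzBoundary Ω)
    (w : EuclideanSpace ℝ (Fin d) → ℝ) (hw : NonlocalDiffusion.MemHs s Set.univ w)
    (f : (Ω → ℝ) →ₗ[ℝ] ℝ)
    (hf : ∃ C : ℝ≥0, ∀ᶠ δ : ℝ in atTop, NonlocalDiffusion.dualNorm s Ω δ f ≤ C)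
    (u : ℝ → EuclideanSpace ℝ (Fin d) → ℝ)
    (hu : ∀ᶠ δ : ℝ in atTop, NonlocalDiffusion.IsNonlocalSolution s Ω δ f w (u δ))
    (uInf : EuclideanSpace ℝ (Fin d) → ℝ)
    (huInf : NonlocalDiffusion.IsFractionalSolution s Ω f w uInf) :
    Tendsto (fun δ : ℝ => NonlocalDiffusion.HsNorm s Ω (u δ - uInf)) atTop (𝓝 0) := by
  open NonlocalDiffusion in
  have hΩf := volume_frontier_eq_zero hΩo hΩL
  obtain ⟨R, hR, hΩR⟩ : ∃ R : ℝ, 0 ≤ R ∧ Ω ⊆ Metric.closedBall 0 R := by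
    obtain ⟨R, hΩR⟩ := hΩb.subset_closedBall 0
    exact ⟨max R 0, le_max_right _ _, hΩR.trans (Metric.closedBall_subset_closedBall
      (le_max_left _ _))⟩
  set K : ℝ := 4 * ((tailMass d s).toReal + 1) / (poincareConst d s R).toReal
  set k : ℝ≥0∞ := (poincareConst d s R)⁻¹ + (ENNReal.ofReal (fracConst d s))⁻¹
  have hk : k ≠ ∞ := ENNReal.add_ne_top.2
    ⟨ENNReal.inv_ne_top.2 (poincareConst_pos hd hs0 hs1 hR).ne',
      ENNReal.inv_ne_top.2 (ENNReal.ofReal_pos.2 (fracConst_pos d hs0 hs1)).ne'⟩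
  have hlim : Tendsto (fun δ : ℝ => (k * ENNReal.ofReal
      (K * ∫ p in farPairs Ω δ, energyDensity s uInf p)) ^ (1 / 2 : ℝ)) atTop (𝓝 0) := by
    have h1 := (tendsto_setIntegral_energyDensity_farPairs hs0 hs1 Ω huInf.mem).const_mul K
    have h2 := ENNReal.Tendsto.const_mul (ENNReal.tendsto_ofReal h1) (Or.inr hk)
    have h3 := h2.ennrpow_const (1 / 2 : ℝ)
    simpa using h3
  refine tendsto_of_tendsto_of_tendsto_of_le_of_le' tendsto_const_nhds hlim
    (Eventually.of_forall fun _ => zero_le) ?_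
  filter_upwards [hu, eventually_ge_atTop (2 * R + 1)] with δ huδ hδ
  have hv := (memVc_and_memHsc_error hs0 hs1 hΩo hΩf (by linarith) huδ.mem huInf.mem
    huδ.dirichlet huInf.dirichlet).2.1
  refine (HsNorm_sub_le hd hs0 hs1 hΩo.measurableSet hR hΩR hδ
    ((memHs_univ_iff hs0 hs1).1 hv).1).trans ?_
  gcongr
  exact setLIntegral_energyDensity_error_le hd hs0 hs1 hΩo hΩf hR hΩR hδ huδ huInf
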